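/- For a finite weighted undirected multigraph $G$ with positive edge conductances $(c_e)_{e\in E(G)}$ and $s,t\in V(G)$, let $\mathrm{Reff}_G(s,t)\in[0,\infty]$ be the minimum of the energy $\sum_{e\in E(G)} f_e^2/c_e$ over all flows $f\in\mathbb{R}^{E(G)}$ that send one unit from $s$ to $t$, with $\mathrm{Reff}_G(s,t)=\infty$ if there is no such flow. If $G$ is connected, a random spanning tree of $G$ is a spanning tree $T$ drawn with probability proportional to $\prod_{e\in E(T)}c_e$. For every $a>0$ there is a constant $C>0$, depending only on $a$, such that the following holds. Let $G$ be a connected finite weighted multigraph with $n$ vertices, $F\subseteq E(G)$, $\epsilon\in(0,1)$, and $s,t\in V(G)$. Sample a random spanning tree $T$ of $G$, and let $H$ be the graph obtained from $G$ by contracting all edges in $E(T)\cap F$ and deleting all edges in $F\setminus E(T)$. For $F'\subseteq F$, let $H\setminus F'$ denote the graph obtained in the same way except that the edges of $F'$ are all deleted, that is, the graph obtained from $G$ by contracting the edges in $(E(T)\cap F)\setminus F'$ and deleting the edges in $(F\setminus E(T))\cup F'$; the images of $s$ and $t$ in it are again denoted $s,t$. Then, with probability at least $1-n^{-a}$, there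 is a set $F'\subseteq F$ (depending on $H$) such that $$\mathrm{Reff}_{H\setminus F'}(s,t)\ \ge\ (1-\epsilon)\,\mathrm{Reff}_G(s,t)\qquad\text{and}\qquad |F'|\ \le\ \frac{C\log n}{\epsilon^2}.$$ -/

import Mathlib

open scoped ENNReal

/-- A weighted undirected multigraph (loops and parallel edges allowed) with vertex set `V` and
edge set the finite set `edges`. The edge `e` joins `src e` and `tgt e`; which end is called the
source is an arbitrary reference orientation, used only to give flows a sign. `cond e` is the
conductance (weight) of `e`. -/
structure WeightedGraph (V E : Type*) where
  edges : Finset E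
  src : E → V
  tgt : E → V
  cond : E → ℝ
  cond_pos : ∀ e ∈ edges, 0 < cond e

namespace WeightedGraph

variable {V E : Type*}

/-- `u` and `v` are joined by a (possibly trivial) path all of whose edges lie in `A`. -/
def Joined (G : WeightedGraph V E) (A : Finset E) : V → V → Prop :=
  Relation.EqvGen fun u v => ∃ e ∈ A, e ∈ G.edges ∧ G.src e = u ∧ G.tgt e = v

/-- The equivalence relation on vertices whose classes are the components of `(V, A)`. -/
def joinedSetoid (G : WeightedGraph V E) (A : Finset E) : Setoid V :=
  Relation.EqvGen.setoid fun u v => ∃ e ∈ A, e ∈ G.edges ∧ G.src e = u ∧ G.tgt e = v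

def Connected (G : WeightedGraph V E) : Prop :=
  ∀ u v, G.Joined G.edges u v

open Classical in
/-- `T` is the edge set of a spanning tree: it connects all vertices and contains no cycle
(no edge of `T` has its ends joined by the other edges of `T`). -/
def IsSpanningTree (G : WeightedGraph V E) (T : Finset E) : Prop :=
  T ⊆ G.edges ∧ (∀ u v, G.Joined T u v) ∧
    ∀ e ∈ T, ¬ G.Joined (T.erase e) (G.src e) (G.tgt e)

open Classical in
noncomputable def spanningTrees (G : WeightedGraph V E) : Finset (Finset E) :=
  G.edges.powerset.filter G.IsSpanningTree

open Classical in
/-- The probability that `P T` holds for a random spanning tree `T`, drawn with probability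
proportional to the product of the conductances of its edges. -/
noncomputable def treeProb (G : WeightedGraph V E) (P : Finset E → Prop) : ℝ :=
  (∑ T ∈ G.spanningTrees.filter P, ∏ e ∈ T, G.cond e) /
    ∑ T ∈ G.spanningTrees, ∏ e ∈ T, G.cond e

open Classical in
/-- Delete the edges in `D`. -/
noncomputable def delete (G : WeightedGraph V E) (D : Finset E) : WeightedGraph V E where
  edges := G.edges \ D
  src := G.src
  tgt := G.tgt
  cond := G.cond
  cond_pos e he := G.cond_pos e (Finset.mem_sdiff.mp he).1

open Classical in
/-- Contract the edges in `A`: the ends of each such edge are identified and the edge removed. -/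
noncomputable def contract (G : WeightedGraph V E) (A : Finset E) :
    WeightedGraph (Quotient (G.joinedSetoid A)) E where
  edges := G.edges \ A
  src e := Quotient.mk _ (G.src e)
  tgt e := Quotient.mk _ (G.tgt e)
  cond := G.cond
  cond_pos e he := G.cond_pos e (Finset.mem_sdiff.mp he).1

open Classical in
/-- `f` sends one unit of flow from `s` to `t`: at each vertex the net outflow is
`[v = s] - [v = t]`. -/
def IsUnitFlow (G : WeightedGraph V E) (s t : V) (f : E → ℝ) : Prop :=
  ∀ v, (∑ e ∈ G.edges with G.src e = v, f e) - (∑ e ∈ G.edges with G.tgt e = v, f e) =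
    (if v = s then 1 else 0) - (if v = t then 1 else 0)

noncomputable def energy (G : WeightedGraph V E) (f : E → ℝ) : ℝ :=
  ∑ e ∈ G.edges, f e ^ 2 / G.cond e

/-- The effective resistance: the least energy of a unit flow from `s` to `t`. It is `∞` if there
is no such flow, that is, if `s` and `t` lie in different components. -/
noncomputable def Reff (G : WeightedGraph V E) (s t : V) : ℝ≥0∞ :=
  ⨅ (f : E → ℝ) (_ : G.IsUnitFlow s t f), ENNReal.ofReal (G.energy f)

open Classical in
/-- The graph `H ∖ F'`, where `H` arises from `G` by contracting the edges of `T ∩ F` and deleting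
those of `F ∖ T`: the edges of `F' ⊆ F` are deleted, the other edges of `T ∩ F` contracted, and
the other edges of `F ∖ T` deleted. For `F' = ∅` this is `H` itself. -/
noncomputable abbrev conditionDelete (G : WeightedGraph V E) (F T F' : Finset E) :
    WeightedGraph
      (Quotient ((G.delete ((F \ T) ∪ F')).joinedSetoid ((T ∩ F) \ F'))) E :=
  (G.delete ((F \ T) ∪ F')).contract ((T ∩ F) \ F')

end WeightedGraph

/-! The tree is exposed on `F` gradually, keeping the effective resistance `R` between `s` and `t` a
martingale with small steps. At each stage some edges are contracted (`K`), some are present (`U`),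
and some conductances have been changed. Among the `k + 1` unexposed edges of `F`, one edge `e`
carries a share `δ ≤ 1/(k + 1)` of the energy of the unit current (`exists_low_energy`). Let `p` be
the probability that `e` is in the tree. If `p ≤ 1/2`, then with probability `(1 - p)/2` the edge is
revealed as absent and deleted; otherwise its conductance doubles. If `p ≥ 1/2`, then with
probability `p/2` it is revealed as present and contracted; otherwise its conductance halves. Both
are exact splittings of the tree measure. As only the likelier outcome is ever revealed, `R` changes
by a factor within `1 ± 2δ`; its mean is unchanged because `p` is `c e` times the resistance across
`e` (`treeSum_contract_eq_drop_mul`).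

Hence `R ^ (-l)` is a supermartingale up to second order terms `O((l/(k + 1))²)`. Each round exposes
`e` with probability at least `1/4`, so these terms can be charged to the exposures
(`exposure_step_le`, `badBound_step`). Over all `k ≥ m` they sum to `O(l²/m)` (`badBound_add`).
Exposure stops when `m` edges of `F` are left, and these form `F'`: deleting them only raises the
resistance. By Markov's inequality the resistance is then below `(1 - ε)` times its initial value
with probability at most `exp (120 l²/m - ε l)`, and `l` of order `ε m` makes this at most `n ^
(-a)` (`treeSum_bad_le`).

Contraction is modelled by restricting to potentials that are flat on `K`, so the vertex set stays
fixed until the end. -/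

namespace WeightedGraph

variable {V E : Type*}

/-! ### Flat potentials, cuts and spanning trees -/

/-- The difference of a potential between two vertices. -/
noncomputable def diff (u v : V) : (V → ℝ) →ₗ[ℝ] ℝ :=
  (LinearMap.proj u : (V → ℝ) →ₗ[ℝ] ℝ) - LinearMap.proj v

@[simp] lemma diff_apply (u v : V) (φ : V → ℝ) : diff u v φ = φ u - φ v := rfl

/-- The difference of a potential along an edge. -/
noncomputable def drop (G : WeightedGraph V E) (e : E) : (V → ℝ) →ₗ[ℝ] ℝ :=
  diff (G.src e) (G.tgt e)

lemma drop_apply (G : WeightedGraph V E) (e : E) (φ : V → ℝ) :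
    G.drop e φ = φ (G.src e) - φ (G.tgt e) := rfl

/-- The potential `φ` is constant along every edge of `A`. -/
def FlatOn (G : WeightedGraph V E) (A : Finset E) (φ : V → ℝ) : Prop :=
  ∀ e ∈ A, G.drop e φ = 0

lemma FlatOn.mono {G : WeightedGraph V E} {A B : Finset E} {φ : V → ℝ}
    (h : G.FlatOn B φ) (hAB : A ⊆ B) : G.FlatOn A φ := fun e he => h e (hAB he)

lemma FlatOn.sub_smul {G : WeightedGraph V E} {A : Finset E} {φ ψ : V → ℝ}
    (h : G.FlatOn A φ) (h' : G.FlatOn A ψ) (r : ℝ) : G.FlatOn A (φ - r • ψ) := by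
  intro e he
  simp [h e he, h' e he]

lemma flatOn_insert [DecidableEq E] {G : WeightedGraph V E} {A : Finset E} {e : E} {φ : V → ℝ} :
    G.FlatOn (insert e A) φ ↔ G.drop e φ = 0 ∧ G.FlatOn A φ := by
  simp [FlatOn]

lemma flatOn_union [DecidableEq E] {G : WeightedGraph V E} {A B : Finset E} {φ : V → ℝ} :
    G.FlatOn (A ∪ B) φ ↔ G.FlatOn A φ ∧ G.FlatOn B φ := by
  simp only [FlatOn, Finset.mem_union]
  exact ⟨fun h => ⟨fun e he => h e (Or.inl he), fun e he => h e (Or.inr he)⟩,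
    fun h e he => he.elim (h.1 e) (h.2 e)⟩

/-- Together with `joined_of_forall_flatOn` this turns connectivity into linear algebra: components
are exactly what flat potentials distinguish. -/
lemma Joined.eq_of_flatOn {G : WeightedGraph V E} {A : Finset E} {u v : V}
    (h : G.Joined A u v) {φ : V → ℝ} (hφ : G.FlatOn A φ) : φ u = φ v := by
  induction h with
  | rel x y h =>
    obtain ⟨e, he, -, rfl, rfl⟩ := h
    exact sub_eq_zero.mp (hφ e he)
  | refl x => rfl
  | symm x y _ ih => exact ih.symm
  | trans x y z _ _ ih ih' => exact ih.trans ih'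

open Classical in
/-- The indicator of the component of `u` is flat. -/
lemma flatOn_component {G : WeightedGraph V E} {A : Finset E} (hA : A ⊆ G.edges) (u : V) :
    G.FlatOn A (fun x => if G.Joined A u x then 1 else 0) := by
  intro e he
  have h1 : G.Joined A (G.src e) (G.tgt e) := .rel _ _ ⟨e, he, hA he, rfl, rfl⟩
  have h2 : G.Joined A u (G.src e) ↔ G.Joined A u (G.tgt e) :=
    ⟨fun h => h.trans _ _ _ h1, fun h => h.trans _ _ _ (h1.symm _ _)⟩
  simp [drop_apply, h2]

/-- Two vertices are joined as soon as no flat potential separates them. -/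
lemma joined_of_forall_flatOn {G : WeightedGraph V E} {A : Finset E} (hA : A ⊆ G.edges) {u v : V}
    (h : ∀ φ, G.FlatOn A φ → φ u = φ v) : G.Joined A u v := by
  classical
  have := h _ (flatOn_component hA u)
  rw [if_pos (show G.Joined A u u from .refl u)] at this
  by_contra hv
  simp [hv] at this

lemma IsSpanningTree.const_of_flatOn {G : WeightedGraph V E} {T : Finset E}
    (hT : G.IsSpanningTree T) {φ : V → ℝ} (hφ : G.FlatOn T φ) (u v : V) : φ u = φ v :=
  (hT.2.1 u v).eq_of_flatOn hφ

/-- The fundamental cut of a tree edge. -/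
lemma IsSpanningTree.exists_cut [DecidableEq E] {G : WeightedGraph V E} {T : Finset E}
    (hT : G.IsSpanningTree T) {e : E} (he : e ∈ T) :
    ∃ χ : V → ℝ, (∀ v, χ v = 0 ∨ χ v = 1) ∧ G.FlatOn (T.erase e) χ ∧ G.drop e χ = 1 := by
  classical
  refine ⟨_, fun v => ?_, by
    convert flatOn_component ((T.erase_subset e).trans hT.1) (G.src e), ?_⟩
  · by_cases h : G.Joined (T.erase e) (G.src e) v <;> simp [h]
  · have h1 := hT.2.2 e he
    have h2 : G.Joined (T.erase e) (G.src e) (G.src e) := .refl _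
    rw [drop_apply, if_pos h2, if_neg (by convert h1), sub_zero]

lemma isSpanningTree_of_potentials [DecidableEq E] {G : WeightedGraph V E} {T : Finset E}
    (hT : T ⊆ G.edges) (h1 : ∀ φ, G.FlatOn T φ → ∀ u v, φ u = φ v)
    (h2 : ∀ e ∈ T, ∃ χ, G.FlatOn (T.erase e) χ ∧ G.drop e χ ≠ 0) : G.IsSpanningTree T := by
  refine ⟨hT, fun u v => joined_of_forall_flatOn hT fun φ hφ => h1 φ hφ u v, fun e he hj => ?_⟩
  obtain ⟨χ, hχ, hχe⟩ := h2 e he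
  refine hχe (sub_eq_zero.mpr (hj.eq_of_flatOn ?_))
  convert hχ

/-- The exchange property of spanning trees across a cut. -/
lemma IsSpanningTree.exchange [DecidableEq E] {G : WeightedGraph V E} {Y : Finset E} {e f : E}
    {χ : V → ℝ} (hT : G.IsSpanningTree (insert e Y)) (hf : f ∈ G.edges) (hχ : G.FlatOn Y χ)
    (hχe : G.drop e χ ≠ 0) (hχf : G.drop f χ ≠ 0) : G.IsSpanningTree (insert f Y) := by
  have hY : Y ⊆ insert e Y := Finset.subset_insert _ _
  have hfY : f ∉ Y := fun h => hχf (hχ f h)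
  refine isSpanningTree_of_potentials
    (Finset.insert_subset hf (hY.trans hT.1)) (fun φ hφ u v => ?_) (fun g hg => ?_)
  · obtain ⟨hφf, hφY⟩ := flatOn_insert.mp hφ
    -- Subtracting `a • χ` makes `φ` flat on the old tree, hence constant; its drop along `f` then
    -- forces `a = 0`.
    set a := G.drop e φ / G.drop e χ with ha
    have hflat : G.FlatOn (insert e Y) (φ - a • χ) := by
      refine flatOn_insert.mpr ⟨?_, hφY.sub_smul hχ a⟩
      simp [ha, hχe]
    have hc := hT.const_of_flatOn hflat
    have h1 : a = 0 := by
      have := sub_eq_zero.mpr (hc (G.src f) (G.tgt f))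
      rw [← drop_apply, map_sub, map_smul, hφf, smul_eq_mul, zero_sub, neg_eq_zero] at this
      exact (mul_eq_zero.mp this).resolve_right hχf
    simpa [h1] using hc u v
  · rcases Finset.mem_insert.mp hg with rfl | hgY
    · exact ⟨χ, by rwa [Finset.erase_insert hfY], hχf⟩
    · obtain ⟨η, -, hη, hηg⟩ := hT.exists_cut (hY hgY)
      have hge : g ≠ e := fun h => hχe (h ▸ hχ g hgY)
      have hgf : g ≠ f := fun h => hfY (h ▸ hgY)
      -- The old cut of `g` is corrected to be flat on `f`; `χ` does not see `g`, so the drop along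
      -- `g` survives.
      refine ⟨η - (G.drop f η / G.drop f χ) • χ, ?_, ?_⟩
      · intro k hk
        obtain ⟨hkg, hk⟩ := Finset.mem_erase.mp hk
        rcases Finset.mem_insert.mp hk with rfl | hk
        · simp [hχf]
        · simp [hχ k hk, hη k (Finset.mem_erase.mpr ⟨hkg, hY hk⟩)]
      · simp [hχ g hgY, hηg]

/-- A connected graph has a spanning tree. -/
lemma Connected.exists_isSpanningTree {G : WeightedGraph V E} (hG : G.Connected) :
    ∃ T, G.IsSpanningTree T := by
  classical
  let S := G.edges.powerset.filter fun A => ∀ u v, G.Joined A u v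
  have hS : S.Nonempty := ⟨G.edges, by simp [S]; exact hG⟩
  obtain ⟨T, hTS, hmin⟩ := S.exists_min_image Finset.card hS
  simp only [S, Finset.mem_filter, Finset.mem_powerset] at hTS hmin
  refine ⟨T, hTS.1, hTS.2, fun e he hj => ?_⟩
  have hsub : T.erase e ⊆ G.edges := (T.erase_subset e).trans hTS.1
  have := hmin (T.erase e) ⟨hsub, fun u v => joined_of_forall_flatOn hsub fun φ hφ =>
    (hTS.2 u v).eq_of_flatOn fun f hf => ?_⟩
  · exact absurd (Finset.card_erase_lt_of_mem he) (by omega)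
  · by_cases hfe : f = e
    · subst hfe
      exact sub_eq_zero.mpr (Joined.eq_of_flatOn (by convert hj) hφ)
    · exact hφ f (Finset.mem_erase.mpr ⟨hfe, hf⟩)

/-! ### Dirichlet form, effective resistance and rank one updates -/

/-- The Dirichlet form of the edges in `U` with conductances `c`. -/
noncomputable def form (G : WeightedGraph V E) (c : E → ℝ) (U : Finset E) :
    (V → ℝ) →ₗ[ℝ] (V → ℝ) →ₗ[ℝ] ℝ :=
  ∑ e ∈ U, c e • (G.drop e).smulRight (G.drop e)

lemma form_apply (G : WeightedGraph V E) (c : E → ℝ) (U : Finset E) (φ ψ : V → ℝ) :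
    G.form c U φ ψ = ∑ e ∈ U, c e * (G.drop e φ * G.drop e ψ) := by
  simp [form]

lemma form_symm (G : WeightedGraph V E) (c : E → ℝ) (U : Finset E) (φ ψ : V → ℝ) :
    G.form c U φ ψ = G.form c U ψ φ := by
  simp only [form_apply, mul_comm (G.drop _ φ)]

lemma form_insert [DecidableEq E] (G : WeightedGraph V E) (c : E → ℝ) {U : Finset E} {e : E}
    (he : e ∉ U) (φ ψ : V → ℝ) :
    G.form c (insert e U) φ ψ = G.form c U φ ψ + c e * (G.drop e φ * G.drop e ψ) := by
  rw [form_apply, Finset.sum_insert he, form_apply, add_comm]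

lemma form_congr (G : WeightedGraph V E) {c c' : E → ℝ} {U : Finset E} (h : ∀ e ∈ U, c e = c' e) :
    G.form c U = G.form c' U :=
  Finset.sum_congr rfl fun e he => by rw [h e he]

lemma form_self_nonneg (G : WeightedGraph V E) {c : E → ℝ} {U : Finset E} (hc : ∀ e ∈ U, 0 < c e)
    (φ : V → ℝ) : 0 ≤ G.form c U φ φ := by
  rw [form_apply]
  exact Finset.sum_nonneg fun e he => mul_nonneg (hc e he).le (mul_self_nonneg _)

lemma flatOn_of_form_self_eq_zero {G : WeightedGraph V E} {c : E → ℝ} {U : Finset E}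
    (hc : ∀ e ∈ U, 0 < c e) {φ : V → ℝ} (h : G.form c U φ φ = 0) : G.FlatOn U φ := by
  rw [form_apply, Finset.sum_eq_zero_iff_of_nonneg
    fun e he => mul_nonneg (hc e he).le (mul_self_nonneg _)] at h
  intro e he
  simpa [(hc e he).ne'] using h e he

/-- `h` represents the functional `ℓ` with respect to the Dirichlet form of `U` on the potentials
that are flat on `K`. -/
def IsRep (G : WeightedGraph V E) (c : E → ℝ) (K U : Finset E) (ℓ : (V → ℝ) →ₗ[ℝ] ℝ)
    (h : V → ℝ) : Prop :=
  G.FlatOn K h ∧ ∀ ψ, G.FlatOn K ψ → G.form c U h ψ = ℓ ψ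

section Rep

variable {G : WeightedGraph V E} {c : E → ℝ} {K U : Finset E}

/-- Reciprocity, from the symmetry of the form. For `ℓ = diff s t` the number `ℓ h` is the effective
resistance. -/
lemma IsRep.apply_comm {ℓ ℓ' : (V → ℝ) →ₗ[ℝ] ℝ} {g h : V → ℝ} (hg : G.IsRep c K U ℓ g)
    (hh : G.IsRep c K U ℓ' h) : ℓ h = ℓ' g := by
  rw [← hg.2 h hh.1, ← hh.2 g hg.1, form_symm]

lemma IsRep.apply_self_nonneg {ℓ : (V → ℝ) →ₗ[ℝ] ℝ} {h : V → ℝ} (hh : G.IsRep c K U ℓ h)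
    (hc : ∀ e ∈ U, 0 < c e) : 0 ≤ ℓ h := by
  rw [← hh.2 h hh.1]
  exact form_self_nonneg G hc h

/-- If `ℓ` vanishes at its representative, it vanishes on all potentials that are flat on `K`. -/
lemma IsRep.apply_eq_zero {ℓ : (V → ℝ) →ₗ[ℝ] ℝ} {h : V → ℝ} (hh : G.IsRep c K U ℓ h)
    (hc : ∀ e ∈ U, 0 < c e) (h0 : ℓ h = 0) {ψ : V → ℝ} (hψ : G.FlatOn K ψ) : ℓ ψ = 0 := by
  have hflat := flatOn_of_form_self_eq_zero hc ((hh.2 h hh.1).trans h0)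
  rw [← hh.2 ψ hψ, form_apply]
  exact Finset.sum_eq_zero fun e he => by rw [hflat e he]; ring

lemma exists_isRep [Fintype V] [DecidableEq E] (hc : ∀ e ∈ U, 0 < c e)
    (hconn : ∀ φ, G.FlatOn (K ∪ U) φ → ∀ u v, φ u = φ v) (u v : V) :
    ∃ h, G.IsRep c K U (diff u v) h := by
  -- Pinning `φ u = 0` removes the constants, so by connectivity the form is positive definite on
  -- `S` and represents every functional.
  let S : Submodule ℝ (V → ℝ) :=
    { carrier := {φ | G.FlatOn K φ ∧ φ u = 0}
      add_mem' := by
        rintro φ ψ ⟨h1, h2⟩ ⟨h3, h4⟩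
        exact ⟨fun e he => by simp [h1 e he, h3 e he], by simp [h2, h4]⟩
      zero_mem' := ⟨fun e _ => by simp, rfl⟩
      smul_mem' := by
        rintro r φ ⟨h1, h2⟩
        exact ⟨fun e he => by simp [h1 e he], by simp [h2]⟩ }
  let Λ : S →ₗ[ℝ] Module.Dual ℝ S := (G.form c U).compl₁₂ S.subtype S.subtype
  have hinj : Function.Injective Λ := by
    rw [injective_iff_map_eq_zero]
    intro φ hφ
    have h0 : G.form c U φ φ = 0 := by simpa [Λ] using LinearMap.congr_fun hφ φ
    have hconst := hconn φ (flatOn_union.mpr ⟨φ.2.1, flatOn_of_form_self_eq_zero hc h0⟩)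
    ext w
    exact (hconst w u).trans φ.2.2
  have hsurj : Function.Surjective Λ :=
    (LinearMap.injective_iff_surjective_of_finrank_eq_finrank
      Subspace.dual_finrank_eq.symm).mp hinj
  obtain ⟨h, hh⟩ := hsurj ((diff u v).comp S.subtype)
  refine ⟨h, h.2.1, fun ψ hψ => ?_⟩
  have hmem : (fun w => ψ w - ψ u) ∈ S :=
    ⟨fun e he => by simpa [drop_apply] using hψ e he, sub_self _⟩
  have key : G.form c U h (fun w => ψ w - ψ u) = diff u v (fun w => ψ w - ψ u) := by
    simpa [Λ] using LinearMap.congr_fun hh ⟨_, hmem⟩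
  rw [form_apply] at key ⊢
  simpa [drop_apply] using key

/-- Rank one update of a representative when the conductance of an edge changes. -/
lemma sub_smul_form_add {Q : (V → ℝ) →ₗ[ℝ] (V → ℝ) →ₗ[ℝ] ℝ} {ℓ d : (V → ℝ) →ₗ[ℝ] ℝ}
    {g h ψ : V → ℝ} (hg : Q g ψ = d ψ) (hh : Q h ψ = ℓ ψ) {τ : ℝ} (hτ : 1 + τ * d g ≠ 0) :
    Q (h - (τ * d h / (1 + τ * d g)) • g) ψ
      + τ * (d (h - (τ * d h / (1 + τ * d g)) • g) * d ψ) = ℓ ψ := by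
  simp only [map_sub, map_smul, LinearMap.sub_apply, LinearMap.smul_apply, smul_eq_mul, hg, hh]
  field_simp
  ring

/-- The representative after changing the conductance of the edge `e` by `τ`. -/
lemma IsRep.update [DecidableEq E] {ℓ : (V → ℝ) →ₗ[ℝ] ℝ} {g h : V → ℝ} {e : E} (he : e ∈ U)
    (hh : G.IsRep c K U ℓ h) (hg : G.IsRep c K U (G.drop e) g) {τ : ℝ}
    (hτ : 1 + τ * G.drop e g ≠ 0) :
    G.IsRep (Function.update c e (c e + τ)) K U ℓ
      (h - (τ * G.drop e h / (1 + τ * G.drop e g)) • g) := by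
  refine ⟨hh.1.sub_smul hg.1 _, fun ψ hψ => ?_⟩
  rw [← sub_smul_form_add (hg.2 ψ hψ) (hh.2 ψ hψ) hτ]
  obtain ⟨U', hU', rfl⟩ : ∃ U', e ∉ U' ∧ insert e U' = U :=
    ⟨U.erase e, Finset.notMem_erase e U, Finset.insert_erase he⟩
  rw [form_insert G _ hU', form_insert G _ hU', Function.update_self,
    form_congr G (c := Function.update c e (c e + τ)) (c' := c)
      fun f hf => Function.update_of_ne (ne_of_mem_of_not_mem hf hU') _ _]
  ring

/-- The representative after deleting the edge `e`. -/
lemma IsRep.delete [DecidableEq E] {ℓ : (V → ℝ) →ₗ[ℝ] ℝ} {g h : V → ℝ} {e : E} (he : e ∉ U)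
    (hh : G.IsRep c K (insert e U) ℓ h) (hg : G.IsRep c K (insert e U) (G.drop e) g)
    (hτ : 1 + -c e * G.drop e g ≠ 0) :
    G.IsRep c K U ℓ (h - (-c e * G.drop e h / (1 + -c e * G.drop e g)) • g) := by
  refine ⟨hh.1.sub_smul hg.1 _, fun ψ hψ => ?_⟩
  rw [← sub_smul_form_add (hg.2 ψ hψ) (hh.2 ψ hψ) hτ, form_insert G _ he]
  ring

/-- The representative after adding the edge `e`. -/
lemma IsRep.addEdge [DecidableEq E] {ℓ : (V → ℝ) →ₗ[ℝ] ℝ} {g h : V → ℝ} {e : E} (he : e ∉ U)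
    (hh : G.IsRep c K U ℓ h) (hg : G.IsRep c K U (G.drop e) g)
    (hτ : 1 + c e * G.drop e g ≠ 0) :
    G.IsRep c K (insert e U) ℓ (h - (c e * G.drop e h / (1 + c e * G.drop e g)) • g) := by
  refine ⟨hh.1.sub_smul hg.1 _, fun ψ hψ => ?_⟩
  rw [← sub_smul_form_add (hg.2 ψ hψ) (hh.2 ψ hψ) hτ, form_insert G _ he]

/-- The representative after contracting an edge. -/
lemma IsRep.contract [DecidableEq E] {ℓ : (V → ℝ) →ₗ[ℝ] ℝ} {g h : V → ℝ} {e : E}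
    (hh : G.IsRep c K U ℓ h) (hg : G.IsRep c K U (G.drop e) g) (hr : G.drop e g ≠ 0) :
    G.IsRep c (insert e K) U ℓ (h - (G.drop e h / G.drop e g) • g) := by
  refine ⟨flatOn_insert.mpr ⟨?_, hh.1.sub_smul hg.1 _⟩, fun ψ hψ => ?_⟩
  · simp [hr]
  · obtain ⟨h1, h2⟩ := flatOn_insert.mp hψ
    simp [hg.2 ψ h2, hh.2 ψ h2, h1]

/-- A flat edge may be dropped from the form. -/
lemma IsRep.of_insert [DecidableEq E] {ℓ : (V → ℝ) →ₗ[ℝ] ℝ} {h : V → ℝ} {e : E} (he : e ∉ U)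
    (hh : G.IsRep c (insert e K) (insert e U) ℓ h) : G.IsRep c (insert e K) U ℓ h := by
  refine ⟨hh.1, fun ψ hψ => ?_⟩
  rw [← hh.2 ψ hψ, form_insert G _ he, (flatOn_insert.mp hψ).1]
  ring

end Rep

/-! ### Weighted tree sums -/

open Classical in
/-- The weighted number of sets `T` with `K ⊆ T ⊆ K ∪ U` that satisfy `P`, the edges of `K` being
left out of the weight. -/
noncomputable def treeSum [DecidableEq E] (c : E → ℝ) (P : Finset E → Prop) (K U : Finset E) : ℝ :=
  ∑ X ∈ U.powerset, if P (K ∪ X) then ∏ e ∈ X, c e else 0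

section TreeSum

variable [DecidableEq E] {c : E → ℝ} {P : Finset E → Prop} {K U : Finset E}

/-- Deletion–contraction: the sets avoiding `e` and those containing it. -/
lemma treeSum_insert (c : E → ℝ) (P : Finset E → Prop) (K : Finset E)
    {U : Finset E} {e : E} (he : e ∉ U) :
    treeSum c P K (insert e U) = treeSum c P K U + c e * treeSum c P (insert e K) U := by
  unfold treeSum
  rw [Finset.sum_powerset_insert he, Finset.mul_sum]
  congr 1
  refine Finset.sum_congr rfl fun X hX => ?_
  have heX : e ∉ X := fun h => he (Finset.mem_powerset.mp hX h)
  have : K ∪ insert e X = insert e K ∪ X := by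
    rw [Finset.union_insert, Finset.insert_union]
  rw [Finset.prod_insert heX]
  simp only [mul_ite, mul_zero]
  rw [this]

lemma treeSum_congr {c c' : E → ℝ} {P P' : Finset E → Prop} {K K' U : Finset E}
    (hc : ∀ e ∈ U, c e = c' e) (hP : ∀ X ⊆ U, P (K ∪ X) ↔ P' (K' ∪ X)) :
    treeSum c P K U = treeSum c' P' K' U := by
  refine Finset.sum_congr rfl fun X hX => ?_
  have hX := Finset.mem_powerset.mp hX
  have h1 := hP X hX
  rw [Finset.prod_congr rfl fun e he => hc e (hX he)]
  by_cases h : P (K ∪ X)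
  · rw [if_pos h, if_pos (h1.mp h)]
  · rw [if_neg h, if_neg fun h' => h (h1.mpr h')]

lemma treeSum_eq_zero (hP : ∀ X ⊆ U, ¬ P (K ∪ X)) : treeSum c P K U = 0 := by
  exact Finset.sum_eq_zero fun X hX => if_neg (hP X (Finset.mem_powerset.mp hX))

lemma treeSum_mono (hc : ∀ e ∈ U, 0 < c e) {P' : Finset E → Prop} (hP : ∀ T, P T → P' T) :
    treeSum c P K U ≤ treeSum c P' K U := by
  refine Finset.sum_le_sum fun X hX => ?_
  have hX := Finset.mem_powerset.mp hX
  have : 0 ≤ ∏ e ∈ X, c e := Finset.prod_nonneg fun e he => (hc e (hX he)).le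
  split_ifs with h1 h2
  · rfl
  · exact absurd (hP _ h1) h2
  · exact this
  · rfl

lemma treeSum_nonneg (hc : ∀ e ∈ U, 0 < c e) : 0 ≤ treeSum c P K U := by
  refine Finset.sum_nonneg fun X hX => ?_
  have hX := Finset.mem_powerset.mp hX
  split_ifs
  · exact Finset.prod_nonneg fun e he => (hc e (hX he)).le
  · rfl

lemma treeSum_pos_iff (hc : ∀ e ∈ U, 0 < c e) :
    0 < treeSum c P K U ↔ ∃ X ⊆ U, P (K ∪ X) := by
  constructor
  · intro h
    by_contra! hX
    exact h.ne' (treeSum_eq_zero hX)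
  · rintro ⟨X, hX, hP⟩
    refine Finset.sum_pos' (fun Y hY => ?_) ⟨X, Finset.mem_powerset.mpr hX, ?_⟩
    · have hY := Finset.mem_powerset.mp hY
      split_ifs
      · exact Finset.prod_nonneg fun e he => (hc e (hY he)).le
      · rfl
    · rw [if_pos hP]
      exact Finset.prod_pos fun e he => hc e (hX he)

lemma const_of_treeSum_pos {G : WeightedGraph V E} (hc : ∀ e ∈ U, 0 < c e)
    (hZ : 0 < treeSum c G.IsSpanningTree K U) {φ : V → ℝ} (hφ : G.FlatOn (K ∪ U) φ) (u v : V) :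
    φ u = φ v := by
  obtain ⟨X, hX, hT⟩ := (treeSum_pos_iff hc).mp hZ
  exact hT.const_of_flatOn (hφ.mono (Finset.union_subset_union_right hX)) u v

/-- A bridge of the graph on `K ∪ U` is separated by a cut that no other edge crosses. -/
lemma exists_cut_of_treeSum_eq_zero {G : WeightedGraph V E} {e : E}
    (hUG : U ⊆ G.edges) (hc : ∀ f ∈ insert e U, 0 < c f)
    (hZ : 0 < treeSum c G.IsSpanningTree K (insert e U))
    (h0 : treeSum c G.IsSpanningTree K U = 0) :
    ∃ χ : V → ℝ, (∀ v, χ v = 0 ∨ χ v = 1) ∧ G.FlatOn (K ∪ U) χ ∧ G.drop e χ = 1 := by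
  have hc' : ∀ f ∈ U, 0 < c f := fun f hf => hc f (Finset.mem_insert_of_mem hf)
  have hno : ∀ X ⊆ U, ¬ G.IsSpanningTree (K ∪ X) := fun X hX hT =>
    ((treeSum_pos_iff hc').mpr ⟨X, hX, hT⟩).ne' h0
  obtain ⟨X, hX, hT⟩ := (treeSum_pos_iff hc).mp hZ
  have heX : e ∈ X := by
    by_contra h
    exact hno X ((Finset.subset_insert_iff_of_notMem h).mp hX) hT
  have heK : e ∉ K := fun h => by
    refine hno (X.erase e) (Finset.subset_insert_iff.mp hX) ?_
    rwa [show K ∪ X.erase e = K ∪ X by grind]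
  set Y := K ∪ X.erase e with hY
  have hTY : K ∪ X = insert e Y := by grind
  have heY : e ∉ Y := by grind
  rw [hTY] at hT
  obtain ⟨χ, h01, hflat, hχe⟩ := hT.exists_cut (Finset.mem_insert_self e Y)
  rw [Finset.erase_insert heY] at hflat
  refine ⟨χ, h01, ?_, hχe⟩
  refine flatOn_union.mpr ⟨hflat.mono Finset.subset_union_left, fun f hf => ?_⟩
  by_contra hχf
  -- An edge of `U` crossing the cut could replace `e`, giving a tree that avoids `e`.
  refine hno (insert f (X.erase e)) ?_ ?_
  · exact Finset.insert_subset hf (Finset.subset_insert_iff.mp hX)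
  · rw [Finset.union_insert]
    exact hT.exchange (hUG hf) hflat (by simp [hχe]) hχf

end TreeSum

/-! ### Kirchhoff's formula -/

/-- A spanning tree contains no edge along which all potentials that are flat on the rest of a set
`K` of tree edges vanish. -/
lemma not_isSpanningTree_of_drop_eq_zero [DecidableEq E] {G : WeightedGraph V E} {K T : Finset E}
    {e : E} (heK : e ∉ K) (hKT : K ⊆ T) (heT : e ∈ T)
    (h : ∀ ψ, G.FlatOn K ψ → G.drop e ψ = 0) : ¬ G.IsSpanningTree T := by
  intro hT
  obtain ⟨χ, -, hflat, hχe⟩ := hT.exists_cut heT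
  have := h χ (hflat.mono (Finset.subset_erase.mpr ⟨hKT, heK⟩))
  simp [this] at hχe

/-- **Kirchhoff's formula**: the ratio of the weights of the spanning trees with and without an edge
`e` is the effective resistance between the ends of `e` in the graph without `e`. -/
theorem treeSum_insert_eq_drop_mul [Fintype V] [DecidableEq E] (G : WeightedGraph V E) {c : E → ℝ}
    (hc : ∀ e ∈ G.edges, 0 < c e) {U : Finset E} (hU : U ⊆ G.edges) {K : Finset E}
    (hKU : Disjoint K U) {e : E} (heG : e ∈ G.edges) (heK : e ∉ K) (heU : e ∉ U)
    (hZ : 0 < treeSum c G.IsSpanningTree K U) {g : V → ℝ} (hg : G.IsRep c K U (G.drop e) g) :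
    treeSum c G.IsSpanningTree (insert e K) U = G.drop e g * treeSum c G.IsSpanningTree K U := by
  induction U using Finset.induction_on generalizing K e g with
  | empty =>
    have hcc : ∀ f ∈ (∅ : Finset E), 0 < c f := by simp
    have hg0 : G.drop e g = 0 := by
      rw [drop_apply, sub_eq_zero]
      exact const_of_treeSum_pos hcc hZ (by simpa using hg.1) _ _
    rw [hg0, zero_mul]
    obtain ⟨X, hX, hT⟩ := (treeSum_pos_iff hcc).mp hZ
    obtain rfl := Finset.subset_empty.mp hX
    rw [Finset.union_empty] at hT
    refine treeSum_eq_zero fun X hX => ?_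
    refine not_isSpanningTree_of_drop_eq_zero heK (K := K) (by grind) (e := e) (by grind) ?_
    intro ψ hψ
    rw [drop_apply, sub_eq_zero]
    exact hT.const_of_flatOn hψ _ _
  | insert f U hfU ih =>
    have hUG : U ⊆ G.edges := (Finset.subset_insert f U).trans hU
    have hfG : f ∈ G.edges := hU (Finset.mem_insert_self f U)
    have hcf := hc f hfG
    have hcU : ∀ f ∈ U, 0 < c f := fun f hf => hc f (hUG hf)
    have hcU' : ∀ e ∈ insert f U, 0 < c e := fun e he => hc e (hU he)
    have hfK : f ∉ K := fun h => Finset.disjoint_left.mp hKU h (Finset.mem_insert_self f U)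
    have hKU' : Disjoint K U := hKU.mono_right (Finset.subset_insert f U)
    have hef : e ≠ f := fun h => heU (h ▸ Finset.mem_insert_self f U)
    have heU' : e ∉ U := fun h => heU (Finset.mem_insert_of_mem h)
    have hKf : Disjoint (insert f K) U := Finset.disjoint_insert_left.mpr ⟨hfU, hKU'⟩
    have heKf : e ∉ insert f K := by simp [hef, heK]
    rw [treeSum_insert _ _ _ hfU, treeSum_insert _ _ _ hfU] at *
    rw [Finset.insert_comm f e K]
    rcases (treeSum_nonneg (P := G.IsSpanningTree) (K := K) hcU).eq_or_lt with hA | hA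
    · -- `f` is a bridge
      obtain ⟨χ, h01, hflat, hχf⟩ := exists_cut_of_treeSum_eq_zero (e := f) hUG hcU'
        (by rwa [treeSum_insert _ _ _ hfU]) hA.symm
      obtain ⟨hχK, hχU⟩ := flatOn_union.mp hflat
      -- The form on `U` does not see `χ`, so a multiple of it may be subtracted to make `f` flat.
      have hg1 : G.IsRep c (insert f K) U (G.drop e) (g - G.drop f g • χ) := by
        refine ⟨flatOn_insert.mpr ⟨by simp [hχf], hg.1.sub_smul hχK _⟩, fun ψ hψ => ?_⟩
        obtain ⟨hψf, hψK⟩ := flatOn_insert.mp hψ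
        have h0 : G.form c U χ ψ = 0 := by
          rw [form_apply]
          exact Finset.sum_eq_zero fun k hk => by rw [hχU k hk]; ring
        rw [← hg.2 ψ hψK, form_insert G _ hfU, hψf]
        simp [h0]
      have hgχ : c f * G.drop f g = G.drop e χ := by
        have h0 : G.form c U g χ = 0 := by
          rw [form_apply]
          exact Finset.sum_eq_zero fun k hk => by rw [hχU k hk]; ring
        rw [← hg.2 χ hχK, form_insert G _ hfU, h0, hχf]
        ring
      have hA1 : 0 < treeSum c G.IsSpanningTree (insert f K) U := by
        rw [← hA, zero_add] at hZ
        exact (pos_iff_pos_of_mul_pos hZ).mp hcf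
      have hB1 := ih hUG hKf heG heKf heU' hA1 hg1
      -- If `e` crosses the cut, exchanging `e` and `f` is a bijection that keeps the weights; if
      -- not, nothing crosses the cut and there is no tree.
      have hB0 : treeSum c G.IsSpanningTree (insert e K) U
          = G.drop e χ ^ 2 * treeSum c G.IsSpanningTree (insert f K) U := by
        by_cases hχe : G.drop e χ = 0
        · rw [hχe, zero_pow two_ne_zero, zero_mul]
          refine treeSum_eq_zero fun X hX hT => ?_
          have := hT.const_of_flatOn (φ := χ) (flatOn_union.mpr
            ⟨flatOn_insert.mpr ⟨hχe, hχK⟩, hχU.mono hX⟩) (G.src f) (G.tgt f)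
          rw [drop_apply, this] at hχf
          simp at hχf
        · have h1 : G.drop e χ ^ 2 = 1 := by
            rw [drop_apply] at hχe ⊢
            rcases h01 (G.src e) with h | h <;> rcases h01 (G.tgt e) with h' | h' <;>
              simp [h, h'] at hχe ⊢
          rw [h1, one_mul]
          refine treeSum_congr (fun _ _ => rfl) fun X hX => ?_
          have hflatX : G.FlatOn (K ∪ X) χ :=
            flatOn_union.mpr ⟨hχK, hχU.mono hX⟩
          rw [Finset.insert_union, Finset.insert_union]
          exact ⟨fun h => h.exchange hfG hflatX hχe (by simp [hχf]),
            fun h => h.exchange heG hflatX (by simp [hχf]) hχe⟩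
      have hge : G.drop e (g - G.drop f g • χ) = G.drop e g - G.drop f g * G.drop e χ := by simp
      rw [hB1, hge, hB0, ← hA, ← hgχ]
      ring
    · obtain ⟨g0, hg0⟩ := exists_isRep hcU (fun φ hφ => const_of_treeSum_pos hcU hA hφ)
        (G.src e) (G.tgt e)
      obtain ⟨h0, hh0⟩ := exists_isRep hcU (fun φ hφ => const_of_treeSum_pos hcU hA hφ)
        (G.src f) (G.tgt f)
      change G.IsRep c K U (G.drop e) g0 at hg0
      change G.IsRep c K U (G.drop f) h0 at hh0
      have hρ := hh0.apply_self_nonneg hcU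
      have hx := hg0.apply_comm hh0
      have hB0 := ih hUG hKU' heG heK heU' hA hg0
      have hA1 := ih hUG hKU' hfG hfK hfU hA hh0
      have hpos : 0 < 1 + c f * G.drop f h0 := by positivity
      have hge : G.drop e g
          = G.drop e g0 - c f * G.drop f g0 / (1 + c f * G.drop f h0) * G.drop e h0 := by
        have := (hg0.addEdge hfU hh0 hpos.ne').apply_comm hg
        rw [this]
        simp
      rcases hρ.eq_or_lt with hρ0 | hρ0
      -- Zero resistance means that flatness on `K` already forces flatness along `f`, so no tree
      -- contains both `K` and `f`.
      · have hψ := fun ψ hψ => hh0.apply_eq_zero hcU hρ0.symm (ψ := ψ) hψ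
        have hB1 : treeSum c G.IsSpanningTree (insert e (insert f K)) U = 0 :=
          treeSum_eq_zero fun X hX =>
            not_isSpanningTree_of_drop_eq_zero hfK (K := K) (by grind) (by grind) hψ
        have : G.drop e h0 = 0 := by rw [hx]; exact hψ _ hg0.1
        rw [hA1, hB1, hB0, hge, this, ← hρ0]
        ring
      · have hA1pos : 0 < treeSum c G.IsSpanningTree (insert f K) U := by
          rw [hA1]; positivity
        have hB1 := ih hUG hKf heG heKf heU' hA1pos (hg0.contract hh0 hρ0.ne')
        have : G.drop e (g0 - (G.drop f g0 / G.drop f h0) • h0)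
            = G.drop e g0 - G.drop f g0 / G.drop f h0 * G.drop e h0 := by simp
        rw [hB1, hA1, hB0, this, hge, hx]
        field_simp
        ring

/-- The probability that an edge lies in the random spanning tree is its conductance times the
effective resistance between its ends. -/
theorem treeSum_contract_eq_drop_mul [Fintype V] [DecidableEq E] (G : WeightedGraph V E)
    {c : E → ℝ} (hc : ∀ e ∈ G.edges, 0 < c e) {U K : Finset E} {e : E} (heU : e ∉ U)
    (hU : insert e U ⊆ G.edges) (hKU : Disjoint K (insert e U))
    (hZ : 0 < treeSum c G.IsSpanningTree K (insert e U)) {g : V → ℝ}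
    (hg : G.IsRep c K (insert e U) (G.drop e) g) :
    treeSum c G.IsSpanningTree (insert e K) U
      = G.drop e g * treeSum c G.IsSpanningTree K (insert e U) := by
  have hUG : U ⊆ G.edges := (Finset.subset_insert e U).trans hU
  have heG : e ∈ G.edges := hU (Finset.mem_insert_self e U)
  have hce := hc e heG
  have hcU : ∀ f ∈ U, 0 < c f := fun f hf => hc f (hUG hf)
  have heK : e ∉ K := fun h => Finset.disjoint_left.mp hKU h (Finset.mem_insert_self e U)
  rw [treeSum_insert _ _ _ heU]
  rcases (treeSum_nonneg (P := G.IsSpanningTree) (K := K) hcU).eq_or_lt with hA | hA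
  · obtain ⟨χ, -, hflat, hχe⟩ := exists_cut_of_treeSum_eq_zero (e := e) hUG
      (fun f hf => hc f (hU hf)) hZ hA.symm
    obtain ⟨hχK, hχU⟩ := flatOn_union.mp hflat
    have hge : c e * G.drop e g = 1 := by
      have h0 : G.form c U g χ = 0 := by
        rw [form_apply]
        exact Finset.sum_eq_zero fun k hk => by rw [hχU k hk]; ring
      rw [← hχe, ← hg.2 χ hχK, form_insert G _ heU, h0, hχe]
      ring
    linear_combination G.drop e g * hA - treeSum c G.IsSpanningTree (insert e K) U * hge
  · obtain ⟨g0, hg0⟩ := exists_isRep hcU (fun φ hφ => const_of_treeSum_pos hcU hA hφ)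
      (G.src e) (G.tgt e)
    change G.IsRep c K U (G.drop e) g0 at hg0
    have hρ := hg0.apply_self_nonneg hcU
    have hpos : 0 < 1 + c e * G.drop e g0 := by positivity
    have hge : G.drop e g = G.drop e g0 / (1 + c e * G.drop e g0) := by
      have := (hg0.addEdge heU hg0 hpos.ne').apply_comm hg
      rw [this]
      simp only [map_sub, map_smul, smul_eq_mul]
      field_simp
      ring
    rw [treeSum_insert_eq_drop_mul G hc hUG (hKU.mono_right (Finset.subset_insert e U))
      heG heK heU hA hg0, hge]
    field_simp

end WeightedGraph

/-! ### Scalar inequalities -/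

/-- A second order upper bound for negative powers near one. -/
lemma one_add_rpow_neg_le {w l : ℝ} (hl : 1 ≤ l) (hw : l * |w| ≤ 2 / 11) :
    (1 + w) ^ (-l) ≤ 1 - l * w + 3 * (l * w) ^ 2 := by
  have hw0 : |w| ≤ 2 / 11 := le_trans (le_mul_of_one_le_left (abs_nonneg w) hl) hw
  obtain ⟨hw1, hw2⟩ := abs_le.mp hw0
  have hpos : 0 < 1 + w := by linarith
  have hlog : w - 11 / 9 * w ^ 2 ≤ Real.log (1 + w) := by
    refine le_trans ?_ (Real.one_sub_inv_le_log_of_pos hpos)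
    have h1 : 1 - (1 + w)⁻¹ = w - (1 + w)⁻¹ * w ^ 2 := by field_simp; ring
    have h2 : (1 + w)⁻¹ ≤ 11 / 9 := by
      rw [inv_le_iff_one_le_mul₀ hpos]; linarith
    rw [h1]
    linarith [mul_le_mul_of_nonneg_right h2 (sq_nonneg w)]
  have habs : |l * w| ≤ 2 / 11 := by rwa [abs_mul, abs_of_pos (by linarith)]
  obtain ⟨h3, h4⟩ := abs_le.mp habs
  have hlw : l * w ^ 2 ≤ (l * w) ^ 2 := by
    rw [mul_pow]
    exact mul_le_mul_of_nonneg_right (by nlinarith) (sq_nonneg w)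
  have hlw0 : 0 ≤ l * w ^ 2 := by positivity
  have hlw1 : (l * w) ^ 2 ≤ (2 / 11) ^ 2 := sq_le_sq' (by linarith) h4
  set z := -(l * w) + 11 / 9 * (l * w ^ 2) with hz
  have hz1 : |z| ≤ 1 := abs_le.mpr ⟨by linarith, by linarith⟩
  have hexp := (abs_le.mp (Real.abs_exp_sub_one_sub_id_le hz1)).2
  have hle : (1 + w) ^ (-l) ≤ Real.exp z := by
    rw [Real.rpow_def_of_pos hpos]
    refine Real.exp_le_exp.mpr ?_
    linarith [mul_le_mul_of_nonneg_left hlog (by linarith : 0 ≤ l)]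
  have hz2 : z ^ 2 ≤ (11 / 9) ^ 2 * (l * w) ^ 2 := by
    have h5 : z = (-1 + 11 / 9 * w) * (l * w) := by rw [hz]; ring
    rw [h5, mul_pow]
    exact mul_le_mul_of_nonneg_right (sq_le_sq' (by linarith) (by linarith)) (sq_nonneg _)
  linarith [sq_nonneg (l * w)]

/-- One step of the exposure of an edge does not increase the potential function. -/
lemma exposure_step_le {q δ η l : ℝ} (hq1 : 1 / 2 ≤ q) (hq2 : q ≤ 1) (hδ : |δ| ≤ η) (hl : 1 ≤ l)
    (hη : l * η ≤ 1 / 11) :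
    q / 2 * Real.exp (-(120 * (l * η) ^ 2)) * (1 + δ / q) ^ (-l)
      + (1 - q / 2) * (1 - δ / (2 - q)) ^ (-l) ≤ 1 := by
  have hη0 : 0 ≤ η := (abs_nonneg δ).trans hδ
  set L := l * η with hL
  have hL0 : 0 ≤ L := by positivity
  have hlδ : |l * δ| ≤ L := by
    rw [abs_mul, abs_of_pos (by linarith)]
    exact mul_le_mul_of_nonneg_left hδ (by linarith)
  have hq0 : 0 < q := by linarith
  have hq3 : 0 < 2 - q := by linarith
  have b1 : |l * (δ / q)| ≤ 2 * L := by
    rw [← mul_div_assoc, abs_div, abs_of_pos hq0, div_le_iff₀ hq0]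
    nlinarith
  have b2 : |l * (-(δ / (2 - q)))| ≤ L := by
    rw [mul_neg, abs_neg, ← mul_div_assoc, abs_div, abs_of_pos hq3, div_le_iff₀ hq3]
    nlinarith
  have e1 : (1 + δ / q) ^ (-l) ≤ 1 - l * (δ / q) + 3 * (2 * L) ^ 2 := by
    refine (one_add_rpow_neg_le hl ?_).trans ?_
    · rw [abs_mul, abs_of_pos (by linarith : 0 < l)] at b1
      linarith
    · have := sq_le_sq' (neg_le_of_abs_le b1) (le_of_abs_le b1)
      linarith
  have e2 : (1 - δ / (2 - q)) ^ (-l) ≤ 1 + l * (δ / (2 - q)) + 3 * L ^ 2 := by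
    rw [sub_eq_add_neg]
    refine (one_add_rpow_neg_le hl ?_).trans ?_
    · rw [abs_mul, abs_of_pos (by linarith : 0 < l)] at b2
      linarith
    · have := sq_le_sq' (neg_le_of_abs_le b2) (le_of_abs_le b2)
      linarith
  have hL2 : L ^ 2 ≤ 1 / 121 := by nlinarith
  -- With `y = 120 * L ^ 2 ≤ 1`, this is `exp (-y) ≤ 1/(1 + y) ≤ 1 - y/2`.
  have hρ : Real.exp (-(120 * L ^ 2)) ≤ 1 - 60 * L ^ 2 := by
    have hy0 : 0 ≤ 120 * L ^ 2 := by positivity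
    have h1 : 120 * L ^ 2 + 1 ≤ Real.exp (120 * L ^ 2) := Real.add_one_le_exp _
    rw [Real.exp_neg]
    refine (inv_anti₀ (by linarith) h1).trans ?_
    rw [inv_le_iff_one_le_mul₀ (by linarith)]
    nlinarith
  set ρ := Real.exp (-(120 * L ^ 2))
  have hρ0 : 0 ≤ ρ := (Real.exp_pos _).le
  -- The linear terms `∓ l * δ / 2` of `t1` and `t2` cancel, as `R` is a martingale; only terms of
  -- order `L ^ 2` remain.
  have t1 : q / 2 * ρ * (1 + δ / q) ^ (-l) ≤ ρ * (q / 2 - l * δ / 2 + 6 * q * L ^ 2) := by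
    refine (mul_le_mul_of_nonneg_left e1 (by positivity)).trans_eq ?_
    field_simp
    ring
  have t2 : (1 - q / 2) * (1 - δ / (2 - q)) ^ (-l)
      ≤ 1 - q / 2 + l * δ / 2 + 3 * (1 - q / 2) * L ^ 2 := by
    refine (mul_le_mul_of_nonneg_left e2 (by linarith)).trans_eq ?_
    field_simp
  obtain ⟨h3, h4⟩ := abs_le.mp hlδ
  have hbase : 1 / 8 ≤ q / 2 - l * δ / 2 + 6 * q * L ^ 2 := by
    have : 0 ≤ 6 * q * L ^ 2 := by positivity
    linarith
  have t3 : ρ * (q / 2 - l * δ / 2 + 6 * q * L ^ 2)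
      ≤ (1 - 60 * L ^ 2) * (q / 2 - l * δ / 2 + 6 * q * L ^ 2) :=
    mul_le_mul_of_nonneg_right hρ (by linarith)
  have t4 : 60 * L ^ 2 * (1 / 8) ≤ 60 * L ^ 2 * (q / 2 - l * δ / 2 + 6 * q * L ^ 2) :=
    mul_le_mul_of_nonneg_left hbase (by positivity)
  -- The discount `60/8` equals the second order cost `3 + 9 * q / 2` at `q = 1`; this fixes the
  -- constant `120`.
  have t5 : 6 * q * L ^ 2 + 3 * (1 - q / 2) * L ^ 2 ≤ 60 * L ^ 2 * (1 / 8) := by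
    nlinarith [sq_nonneg L]
  linarith

namespace WeightedGraph

variable {V E : Type*}

/-! ### The exposure process -/

/-- Deleting at most `m` edges of `F` and contracting the other edges of `T ∩ F` leaves a graph
whose effective conductance between `s` and `t` is at most `C₀`, as witnessed by a potential. -/
def IsGood [DecidableEq E] (G : WeightedGraph V E) (F : Finset E) (s t : V) (m : ℕ) (C₀ : ℝ)
    (T : Finset E) : Prop :=
  ∃ F' ⊆ F, F'.card ≤ m ∧ ∃ φ : V → ℝ, G.FlatOn ((T ∩ F) \ F') φ ∧ diff s t φ = 1 ∧
    ∑ e ∈ G.edges \ F, G.cond e * G.drop e φ ^ 2 ≤ C₀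

/-- A stage of the exposure of the tree on `F`: the edges of `K` are contracted, those of `U` are
still present, and the conductances on `F` have been replaced by `c`. -/
structure IsStage [DecidableEq E] (G : WeightedGraph V E) (F : Finset E) (c : E → ℝ)
    (K U : Finset E) : Prop where
  subset : U ⊆ G.edges
  disj : Disjoint K U
  sdiff_subset : G.edges \ F ⊆ U
  pos : ∀ e ∈ G.edges, 0 < c e
  cond_eq : ∀ e ∉ F, c e = G.cond e
  treeSum_pos : 0 < treeSum c G.IsSpanningTree K U

/-- The bound `N ≤ M (C₀ R)^(-l) Z + err Z` on the weight `N` of the bad trees, at every stage with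
`k` unexposed edges in `F`. -/
def BadBound [DecidableEq E] (G : WeightedGraph V E) (F : Finset E) (s t : V) (m : ℕ) (C₀ l : ℝ)
    (k : ℕ) (M err : ℝ) : Prop :=
  ∀ (c : E → ℝ) (K U : Finset E) (h : V → ℝ), G.IsStage F c K U → (U ∩ F).card = k →
    G.IsRep c K U (diff s t) h → 0 < diff s t h →
    treeSum c (fun T => G.IsSpanningTree T ∧ ¬ G.IsGood F s t m C₀ T) K U
      ≤ (M * (C₀ * diff s t h) ^ (-l) + err) * treeSum c G.IsSpanningTree K U

section

variable [DecidableEq E] {G : WeightedGraph V E} {F : Finset E} {s t : V} {m k : ℕ} {C₀ l : ℝ}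

lemma treeSum_update (c : E → ℝ) (P : Finset E → Prop) (K : Finset E) {U : Finset E} {e : E}
    (he : e ∉ U) (a : ℝ) :
    treeSum (Function.update c e a) P K (insert e U)
      = treeSum c P K U + a * treeSum c P (insert e K) U := by
  have h : ∀ f ∈ U, Function.update c e a f = c f := fun f hf =>
    Function.update_of_ne (ne_of_mem_of_not_mem hf he) _ _
  rw [treeSum_insert _ _ _ he, Function.update_self, treeSum_congr h fun _ _ => Iff.rfl,
    treeSum_congr h fun _ _ => Iff.rfl]

/-- The end of the process. If `C₀ * R ≤ 1`, the right side exceeds the weight of all trees, as in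
Markov's inequality. Otherwise deleting all unexposed edges of `F` works for every tree: `R⁻¹ • h`
has energy at most `1/R < C₀`. -/
lemma badBound_of_card_le (hC₀ : 0 < C₀) (hl : 0 ≤ l) (hk : k ≤ m) :
    G.BadBound F s t m C₀ l k 1 0 := by
  intro c K U h hst hcard hh hR
  have hcU : ∀ e ∈ U, 0 < c e := fun e he => hst.pos e (hst.subset he)
  have hle := treeSum_mono (K := K) hcU
    (P := fun T => G.IsSpanningTree T ∧ ¬ G.IsGood F s t m C₀ T) (P' := G.IsSpanningTree)
    fun T hT => hT.1
  have hZ := hst.treeSum_pos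
  rw [one_mul, add_zero]
  by_cases hC : C₀ * diff s t h ≤ 1
  · have : 1 ≤ (C₀ * diff s t h) ^ (-l) :=
      Real.one_le_rpow_of_pos_of_le_one_of_nonpos (by positivity) hC (by linarith)
    exact hle.trans (le_mul_of_one_le_left hZ.le this)
  · push Not at hC
    rw [treeSum_eq_zero]
    · positivity
    · rintro X hX ⟨-, hbad⟩
      refine hbad ⟨U ∩ F, Finset.inter_subset_right, by omega, (diff s t h)⁻¹ • h, ?_, ?_, ?_⟩
      · intro e he
        have heK : e ∈ K := by grind
        rw [map_smul, hh.1 e heK, smul_zero]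
      · rw [map_smul, smul_eq_mul, inv_mul_cancel₀ hR.ne']
      · have h1 : ∑ e ∈ G.edges \ F, G.cond e * G.drop e h ^ 2 ≤ diff s t h := by
          rw [← hh.2 h hh.1, form_apply]
          refine (Finset.sum_le_sum_of_subset_of_nonneg hst.sdiff_subset
            (f := fun e => c e * (G.drop e h * G.drop e h)) fun e he _ =>
              mul_nonneg (hcU e he).le (mul_self_nonneg _)).trans' (le_of_eq ?_)
          refine Finset.sum_congr rfl fun e he => ?_
          rw [hst.cond_eq e (Finset.mem_sdiff.mp he).2, sq]
        have h2 : ∑ e ∈ G.edges \ F, G.cond e * G.drop e ((diff s t h)⁻¹ • h) ^ 2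
            = (diff s t h)⁻¹ ^ 2 * ∑ e ∈ G.edges \ F, G.cond e * G.drop e h ^ 2 := by
          rw [Finset.mul_sum]
          refine Finset.sum_congr rfl fun e _ => ?_
          rw [map_smul, smul_eq_mul]
          ring
        rw [h2]
        refine (mul_le_mul_of_nonneg_left h1 (by positivity)).trans ?_
        rw [sq, mul_assoc, inv_mul_cancel₀ hR.ne', mul_one, inv_le_iff_one_le_mul₀ hR]
        exact hC.le

/-- Among the unexposed edges of `F` there is one with a small share of the energy. -/
lemma exists_low_energy {c : E → ℝ} {K U : Finset E} {h : V → ℝ} (hst : G.IsStage F c K U)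
    (hcard : (U ∩ F).card = k + 1) (hh : G.IsRep c K U (diff s t) h) :
    ∃ e ∈ U ∩ F, c e * G.drop e h ^ 2 ≤ diff s t h / (k + 1 : ℕ) := by
  have hcU : ∀ e ∈ U, 0 < c e := fun e he => hst.pos e (hst.subset he)
  refine Finset.exists_le_of_sum_le (Finset.card_pos.mp (by omega)) ?_
  rw [Finset.sum_const, hcard, nsmul_eq_mul, mul_div_cancel₀ _ (by positivity), ← hh.2 h hh.1,
    form_apply]
  simp only [← sq]
  exact Finset.sum_le_sum_of_subset_of_nonneg Finset.inter_subset_left fun e he _ =>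
    mul_nonneg (hcU e he).le (sq_nonneg _)

/-- Exposing one unit of information about an edge of low energy. -/
lemma badBound_step [Fintype V] (hC₀ : 0 < C₀) (hl : 1 ≤ l) {M M' err : ℝ}
    (hk : l / (k + 1 : ℕ) ≤ 1 / 11) (hM' : 0 ≤ M') (herr : 0 ≤ err)
    (hM : M ≤ M' * Real.exp (-(120 * (l / (k + 1 : ℕ)) ^ 2)))
    (ih : G.BadBound F s t m C₀ l k M 0) (ih' : G.BadBound F s t m C₀ l (k + 1) M' err) :
    G.BadBound F s t m C₀ l (k + 1) M' (3 / 4 * err) := by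
  intro c K U h hst hcard hh hR
  obtain ⟨e, he, hlow⟩ := exists_low_energy hst hcard hh
  obtain ⟨heU, heF⟩ := Finset.mem_inter.mp he
  have hcU : ∀ e ∈ U, 0 < c e := fun e he => hst.pos e (hst.subset he)
  have hce : 0 < c e := hcU e heU
  have heG : e ∈ G.edges := hst.subset heU
  have hZ := hst.treeSum_pos
  obtain ⟨g, hg⟩ := exists_isRep hcU (fun φ hφ => const_of_treeSum_pos hcU hZ hφ)
    (G.src e) (G.tgt e)
  change G.IsRep c K U (G.drop e) g at hg
  have hr := hg.apply_self_nonneg hcU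
  have hx : diff s t g = G.drop e h := (hg.apply_comm hh).symm
  obtain ⟨U', heU', rfl⟩ : ∃ U', e ∉ U' ∧ insert e U' = U :=
    ⟨U.erase e, Finset.notMem_erase e U, Finset.insert_erase heU⟩
  have hU'G : U' ⊆ G.edges := (Finset.subset_insert e U').trans hst.subset
  have hcU' : ∀ e ∈ U', 0 < c e := fun e he => hst.pos e (hU'G he)
  have hB := treeSum_contract_eq_drop_mul G hst.pos heU' hst.subset hst.disj hZ hg
  have hsdiff : G.edges \ F ⊆ U' := fun f hf => by
    have := hst.sdiff_subset hf
    grind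
  have hcard' : (U' ∩ F).card = k := by
    rw [Finset.insert_inter_of_mem heF, Finset.card_insert_of_notMem (by grind)] at hcard
    omega
  have hA := treeSum_insert c G.IsSpanningTree K heU'
  have hN := treeSum_insert c (fun T => G.IsSpanningTree T ∧ ¬ G.IsGood F s t m C₀ T) K heU'
  have hstage : ∀ a : ℝ, 0 < a → G.IsStage F (Function.update c e a) K (insert e U') := by
    intro a ha
    have hpos : ∀ f ∈ G.edges, 0 < Function.update c e a f := fun f hf => by
      by_cases hfe : f = e
      · subst hfe; simpa using ha
      · rw [Function.update_of_ne hfe]; exact hst.pos f hf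
    refine ⟨hst.subset, hst.disj, hst.sdiff_subset, hpos, fun f hf => ?_, ?_⟩
    · rw [Function.update_of_ne (ne_of_mem_of_not_mem heF hf).symm]; exact hst.cond_eq f hf
    · exact (treeSum_pos_iff fun f hf => hpos f (hst.subset hf)).mpr
        ((treeSum_pos_iff hcU).mp hZ)
  set N₀ := treeSum c (fun T => G.IsSpanningTree T ∧ ¬ G.IsGood F s t m C₀ T) K U' with hN₀
  set N₁ := treeSum c (fun T => G.IsSpanningTree T ∧ ¬ G.IsGood F s t m C₀ T) (insert e K) U'
    with hN₁
  set N := treeSum c (fun T => G.IsSpanningTree T ∧ ¬ G.IsGood F s t m C₀ T) K (insert e U')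
    with hNdef
  set A := treeSum c G.IsSpanningTree K U' with hAdef
  set B := treeSum c G.IsSpanningTree (insert e K) U' with hBdef
  set Z := treeSum c G.IsSpanningTree K (insert e U') with hZdef
  set x := G.drop e h with hxdef
  set r := G.drop e g with hrdef
  set R := diff s t h with hRdef
  set p := c e * r with hp
  set δ := c e * x ^ 2 / R with hδ
  have hcB : c e * B = p * Z := by rw [hB, hp]; ring
  have hAp : A = (1 - p) * Z := by linarith
  have hA0 : 0 ≤ A := treeSum_nonneg hcU'
  have hp0 : 0 ≤ p := by positivity
  have hp1 : p ≤ 1 := by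
    by_contra! hp1
    have : (1 - p) * Z < 0 := mul_neg_of_neg_of_pos (by linarith) hZ
    linarith
  have hδ0 : 0 ≤ δ := by positivity
  have hδ1 : δ ≤ 1 / (k + 1 : ℕ) := by
    rw [hδ, div_le_iff₀ hR]
    exact hlow.trans_eq (by ring)
  have hk' : l * (1 / (k + 1 : ℕ)) ≤ 1 / 11 := by rwa [mul_one_div]
  have hk'' : (1 : ℝ) / (k + 1 : ℕ) ≤ 1 / 11 :=
    le_trans (le_mul_of_one_le_left (by positivity) hl) hk'
  have hδR : c e * x ^ 2 = δ * R := by rw [hδ, div_mul_cancel₀ _ hR.ne']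
  have hω0 : 0 < (C₀ * R) ^ (-l) := by positivity
  set ω := (C₀ * R) ^ (-l) with hω
  have hscale : ∀ w : ℝ, 0 < 1 + w → (C₀ * (R * (1 + w))) ^ (-l) = ω * (1 + w) ^ (-l) := by
    intro w hw
    rw [← mul_assoc, Real.mul_rpow (by positivity) hw.le]
  rw [← mul_one_div] at hM
  -- Both cases at once: `q` is the probability of the likelier outcome for `e`, `N'` the bad weight
  -- of the branch revealing it, `N''` that of the branch with changed conductance. The latter has
  -- mass at most `3/4`, whence the factor on `err`.
  have hfinal : ∀ q δ' N' N'' : ℝ, 1 / 2 ≤ q → q ≤ 1 → |δ'| ≤ 1 / (k + 1 : ℕ) →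
      N' ≤ M * (ω * (1 + δ' / q) ^ (-l)) * (q / 2 * Z) →
      N'' ≤ (M' * (ω * (1 - δ' / (2 - q)) ^ (-l)) + err) * ((1 - q / 2) * Z) →
      N' + N'' ≤ (M' * ω + 3 / 4 * err) * Z := by
    intro q δ' N' N'' hq1 hq2 hδ' h1 h2
    have key := exposure_step_le hq1 hq2 hδ' hl hk'
    have hq0 : 0 < q := by linarith
    have hw : 0 < 1 + δ' / q := by
      have : |δ' / q| ≤ 2 / 11 := by
        rw [abs_div, abs_of_pos hq0, div_le_iff₀ hq0]
        linarith
      linarith [neg_le_of_abs_le this]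
    have h1' : N' ≤ M' * Real.exp (-(120 * (l * (1 / (k + 1 : ℕ))) ^ 2))
        * (ω * (1 + δ' / q) ^ (-l)) * (q / 2 * Z) := by
      refine h1.trans ?_
      gcongr
    have h3 := mul_le_mul_of_nonneg_left key (by positivity : 0 ≤ M' * ω * Z)
    have h4 : err * ((1 - q / 2) * Z) ≤ 3 / 4 * err * Z := by
      have : err * Z * (1 - q / 2) ≤ err * Z * (3 / 4) :=
        mul_le_mul_of_nonneg_left (by linarith) (by positivity)
      linarith
    linarith
  have habs : |δ| ≤ 1 / (k + 1 : ℕ) := by rwa [abs_of_nonneg hδ0]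
  -- For `p ≤ 1/2`, split `N = N₀ / 2 + (N₀ + 2 * c e * N₁) / 2`: delete `e`, or double its
  -- conductance.
  rcases le_total p (1 / 2) with hp2 | hp2
  · have hA1 : 0 < A := by rw [hAp]; exact mul_pos (by linarith) hZ
    have hτ : 1 + -c e * r ≠ 0 := by rw [neg_mul, ← hp]; linarith
    have hτ' : 1 + c e * r ≠ 0 := by rw [← hp]; linarith
    have i1 := ih c K U' _ ⟨hU'G, hst.disj.mono_right (Finset.subset_insert e U'), hsdiff, hst.pos,
      hst.cond_eq, hA1⟩ hcard' (hh.delete heU' hg hτ)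
    have i2 := ih' _ K _ _ (hstage (c e + c e) (by linarith)) hcard (hh.update heU hg hτ')
    have r1 : diff s t (h - (-c e * x / (1 + -c e * r)) • g) = R * (1 + δ / (1 - p)) := by
      rw [map_sub, map_smul, hx, smul_eq_mul, ← hRdef, neg_mul (c e) r, ← hp]
      have : 1 - p ≠ 0 := by linarith
      have : 1 + -p ≠ 0 := by linarith
      field_simp
      linear_combination (1 - p) * hδR
    have r2 : diff s t (h - (c e * x / (1 + c e * r)) • g) = R * (1 - δ / (1 + p)) := by
      rw [map_sub, map_smul, hx, smul_eq_mul, ← hRdef, ← hp]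
      have : 1 + p ≠ 0 := by linarith
      field_simp
      linear_combination -hδR
    have w1 : 0 < 1 + δ / (1 - p) := by
      have : 0 ≤ δ / (1 - p) := div_nonneg hδ0 (by linarith)
      linarith
    have w2 : 0 < 1 - δ / (1 + p) := by
      have : δ / (1 + p) ≤ 1 / 11 := by
        rw [div_le_iff₀ (by linarith)]
        linarith
      linarith
    rw [r1] at i1
    rw [r2] at i2
    have i1 := i1 (by positivity)
    have i2 := i2 (by positivity)
    rw [treeSum_update _ _ _ heU', treeSum_update _ _ _ heU', sub_eq_add_neg,
      hscale _ (by linarith)] at i2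
    rw [hscale _ w1] at i1
    rw [← hN₀, ← hAdef] at i1
    rw [← hN₀, ← hN₁, ← hAdef, ← hBdef] at i2
    have := hfinal (1 - p) δ (N₀ / 2) ((N₀ + (c e + c e) * N₁) / 2) (by linarith) (by linarith)
      habs ?_ ?_
    · linarith
    · rw [hAp] at i1
      linarith
    · have e1 : 2 - (1 - p) = 1 + p := by ring
      have e2 : A + (c e + c e) * B = (1 + p) * Z := by linarith
      rw [e2] at i2
      rw [e1, sub_eq_add_neg 1 (δ / (1 + p))]
      linarith
  -- For `p ≥ 1/2`, split `N = c e / 2 * N₁ + (N₀ + c e / 2 * N₁)`: contract `e`, or halve its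
  -- conductance.
  · have hr0 : r ≠ 0 := by
      rintro h0
      rw [h0, mul_zero] at hp
      linarith
    have hp' : 0 < p := by linarith
    have hB1 : 0 < B := by rw [hB]; positivity
    have hτ : 1 + -(c e / 2) * r ≠ 0 := by
      have : 1 + -(c e / 2) * r = 1 - p / 2 := by rw [hp]; ring
      rw [this]; linarith
    have i1 := ih c (insert e K) U' _ ⟨hU'G, Finset.disjoint_insert_left.mpr ⟨heU',
      hst.disj.mono_right (Finset.subset_insert e U')⟩, hsdiff, hst.pos,
      hst.cond_eq, hB1⟩ hcard' ((hh.contract hg hr0).of_insert heU')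
    have i2 := ih' _ K _ _ (hstage (c e + -(c e / 2)) (by linarith)) hcard (hh.update heU hg hτ)
    have e1 : 1 + -(c e / 2) * r = 1 - p / 2 := by rw [hp]; ring
    have r1 : diff s t (h - (x / r) • g) = R * (1 + -δ / p) := by
      rw [map_sub, map_smul, hx, smul_eq_mul, ← hRdef]
      have : x / r * x = δ * R / p := by
        rw [← hδR, hp]
        field_simp
      rw [this]
      ring
    have r2 : diff s t (h - (-(c e / 2) * x / (1 + -(c e / 2) * r)) • g)
        = R * (1 + δ / (2 - p)) := by
      rw [map_sub, map_smul, hx, smul_eq_mul, ← hRdef, e1]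
      have h2 : 2 - p ≠ 0 := by linarith
      have h3 : 1 - p / 2 = (2 - p) / 2 := by ring
      rw [h3]
      field_simp
      linear_combination hδR
    have w1 : 0 < 1 + -δ / p := by
      have : δ / p ≤ 2 / 11 := by
        rw [div_le_iff₀ hp']
        linarith
      rw [neg_div]
      linarith
    have w2 : 0 < 1 + δ / (2 - p) := by
      have : 0 ≤ δ / (2 - p) := div_nonneg hδ0 (by linarith)
      linarith
    rw [r1] at i1
    rw [r2] at i2
    have i1 := i1 (by positivity)
    have i2 := i2 (by positivity)
    rw [treeSum_update _ _ _ heU', treeSum_update _ _ _ heU', hscale _ w2] at i2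
    rw [hscale _ w1] at i1
    rw [← hN₁, ← hBdef] at i1
    rw [← hN₀, ← hN₁, ← hAdef, ← hBdef] at i2
    have := hfinal p (-δ) (c e / 2 * N₁) (N₀ + (c e + -(c e / 2)) * N₁) hp2 hp1
      (by rwa [abs_neg]) ?_ ?_
    · linarith
    · have := mul_le_mul_of_nonneg_left i1 (by positivity : 0 ≤ c e / 2)
      refine this.trans_eq ?_
      linear_combination M * (ω * (1 + -δ / p) ^ (-l)) / 2 * hcB
    · have e2 : A + (c e + -(c e / 2)) * B = (1 - p / 2) * Z := by linarith
      rw [e2] at i2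
      rwa [neg_div, sub_neg_eq_add]

end

/-- The tail bound at every stage with at least `m` unexposed edges. -/
lemma badBound_add [Fintype V] [DecidableEq E] {G : WeightedGraph V E} {F : Finset E} {s t : V}
    {m : ℕ} {C₀ l : ℝ} (hC₀ : 0 < C₀) (hl : 1 ≤ l) (hm : 0 < m) (hlm : l / m ≤ 1 / 11) (i : ℕ) :
    G.BadBound F s t m C₀ l (m + i)
      (Real.exp (120 * l ^ 2 * (1 / m - 1 / (m + i : ℕ)))) 0 := by
  induction i with
  | zero => simpa using badBound_of_card_le hC₀ (by linarith) le_rfl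
  | succ i ih =>
    have hm' : (0 : ℝ) < m := by exact_mod_cast hm
    have hmi : (0 : ℝ) < (m + i : ℕ) := by exact_mod_cast (by omega : 0 < m + i)
    have hsucc : ((m + i + 1 : ℕ) : ℝ) = (m + i : ℕ) + 1 := by push_cast; ring
    set M' := Real.exp (120 * l ^ 2 * (1 / m - 1 / (m + i + 1 : ℕ))) with hM'
    -- The branch that changes a conductance exposes no edge, so the process need not terminate. The
    -- trivial bound, with error `1`, is improved by `3/4` in each round, and the error vanishes in
    -- the limit.
    have hall : ∀ j : ℕ, G.BadBound F s t m C₀ l (m + i + 1) M' ((3 / 4) ^ j) := by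
      intro j
      induction j with
      | zero =>
        intro c K U h hst _ _ hR
        have hcU : ∀ e ∈ U, 0 < c e := fun e he => hst.pos e (hst.subset he)
        have hZ := hst.treeSum_pos
        refine (treeSum_mono hcU fun T hT => hT.1).trans (le_mul_of_one_le_left hZ.le ?_)
        have : 0 ≤ M' * (C₀ * diff s t h) ^ (-l) := by positivity
        rw [pow_zero]
        linarith
      | succ j ihj =>
        rw [pow_succ']
        refine badBound_step hC₀ hl ?_ (by positivity) (by positivity) ?_ ih ihj
        · refine le_trans ?_ hlm
          gcongr
          omega
        · rw [hM', ← Real.exp_add, Real.exp_le_exp, hsucc]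
          -- The squared step sizes telescope.
          have h1 : 1 / (((m + i : ℕ) : ℝ) + 1) ^ 2
              ≤ 1 / ((m + i : ℕ) : ℝ) - 1 / (((m + i : ℕ) : ℝ) + 1) := by
            rw [div_sub_div _ _ hmi.ne' (by positivity), div_le_div_iff₀ (by positivity)
              (by positivity)]
            nlinarith
          have h2 := mul_le_mul_of_nonneg_left h1 (by positivity : 0 ≤ 120 * l ^ 2)
          rw [div_pow, ← mul_one_div (l ^ 2)]
          linarith
    intro c K U h hst hcard hh hR
    have hlim : Filter.Tendsto (fun j : ℕ => (M' * (C₀ * diff s t h) ^ (-l) + (3 / 4) ^ j)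
        * treeSum c G.IsSpanningTree K U) Filter.atTop
        (nhds ((M' * (C₀ * diff s t h) ^ (-l) + 0) * treeSum c G.IsSpanningTree K U)) :=
      ((tendsto_pow_atTop_nhds_zero_of_lt_one (by norm_num) (by norm_num)).const_add _).mul_const _
    exact ge_of_tendsto' hlim fun j => hall j c K U h hst hcard hh hR

/-- The weight of the bad trees of a connected graph. -/
lemma treeSum_bad_le [Fintype V] [DecidableEq E] {G : WeightedGraph V E} {F : Finset E} {s t : V}
    {m : ℕ} {C₀ l : ℝ} (hC₀ : 0 < C₀) (hl : 1 ≤ l) (hm : 0 < m) (hlm : l / m ≤ 1 / 11)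
    (hZ : 0 < treeSum G.cond G.IsSpanningTree ∅ G.edges) {h : V → ℝ}
    (hh : G.IsRep G.cond ∅ G.edges (diff s t) h) (hR : 0 < diff s t h) :
    treeSum G.cond (fun T => G.IsSpanningTree T ∧ ¬ G.IsGood F s t m C₀ T) ∅ G.edges
      ≤ Real.exp (120 * l ^ 2 / m) * (C₀ * diff s t h) ^ (-l)
        * treeSum G.cond G.IsSpanningTree ∅ G.edges := by
  have hst : G.IsStage F G.cond ∅ G.edges :=
    ⟨subset_rfl, Finset.disjoint_empty_left _, Finset.sdiff_subset, G.cond_pos, fun _ _ => rfl, hZ⟩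
  obtain ⟨M, hM, hbound⟩ : ∃ M ≤ Real.exp (120 * l ^ 2 / m),
      G.BadBound F s t m C₀ l (G.edges ∩ F).card M 0 := by
    rcases le_total (G.edges ∩ F).card m with hk | hk
    · exact ⟨1, Real.one_le_exp (by positivity), badBound_of_card_le hC₀ (by linarith) hk⟩
    · obtain ⟨i, hi⟩ := Nat.exists_eq_add_of_le hk
      refine ⟨_, ?_, hi ▸ badBound_add hC₀ hl hm hlm i⟩
      rw [Real.exp_le_exp, mul_sub, mul_one_div]
      exact sub_le_self _ (by positivity)
  refine (hbound _ _ _ h hst rfl hh hR).trans ?_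
  rw [add_zero]
  gcongr

/-! ### Back to probabilities, flows and quotient graphs -/

lemma one_sub_le_treeProb [DecidableEq E] {G : WeightedGraph V E} {P Q : Finset E → Prop} {θ : ℝ}
    (hZ : 0 < treeSum G.cond G.IsSpanningTree ∅ G.edges) (hQP : ∀ T, Q T → P T)
    (hN : treeSum G.cond (fun T => G.IsSpanningTree T ∧ ¬ Q T) ∅ G.edges
      ≤ θ * treeSum G.cond G.IsSpanningTree ∅ G.edges) :
    1 - θ ≤ G.treeProb P := by
  classical
  have hsum : ∀ P' : Finset E → Prop,
      treeSum G.cond (fun T => G.IsSpanningTree T ∧ P' T) ∅ G.edges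
        = ∑ T ∈ G.spanningTrees.filter P', ∏ e ∈ T, G.cond e := by
    intro P'
    rw [spanningTrees, Finset.filter_filter, Finset.sum_filter, treeSum]
    simp only [Finset.empty_union]
  have hZ' : treeSum G.cond G.IsSpanningTree ∅ G.edges
      = ∑ T ∈ G.spanningTrees, ∏ e ∈ T, G.cond e := by
    rw [spanningTrees, Finset.sum_filter, treeSum]
    simp only [Finset.empty_union]
  have hmono := treeSum_mono (K := ∅) G.cond_pos
    (P := fun T => G.IsSpanningTree T ∧ ¬ P T) (P' := fun T => G.IsSpanningTree T ∧ ¬ Q T)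
    fun T hT => ⟨hT.1, fun h => hT.2 (hQP T h)⟩
  have hsplit : treeSum G.cond (fun T => G.IsSpanningTree T ∧ P T) ∅ G.edges
      + treeSum G.cond (fun T => G.IsSpanningTree T ∧ ¬ P T) ∅ G.edges
        = treeSum G.cond G.IsSpanningTree ∅ G.edges := by
    rw [hsum, hsum, hZ']
    convert Finset.sum_filter_add_sum_filter_not G.spanningTrees P _
  rw [treeProb, ← hZ', ← hsum, le_div_iff₀ hZ]
  linarith

/-- The current of a harmonic potential bounds the effective resistance. -/
lemma Reff_le_diff [DecidableEq E] {G : WeightedGraph V E} {s t : V} {h : V → ℝ}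
    (hh : G.IsRep G.cond ∅ G.edges (diff s t) h) :
    G.Reff s t ≤ ENNReal.ofReal (diff s t h) := by
  classical
  refine (iInf₂_le (fun e => G.cond e * G.drop e h) fun v => ?_).trans (le_of_eq ?_)
  -- Testing against the indicator of `v` is Kirchhoff's node law for the current at `v`.
  · have key := hh.2 (Pi.single v 1) fun e he => absurd he (Finset.notMem_empty e)
    rw [form_apply, diff_apply] at key
    simp only [Pi.single_apply, drop_apply] at key
    simp only [eq_comm (a := v)]
    rw [← key, Finset.sum_filter, Finset.sum_filter, ← Finset.sum_sub_distrib]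
    refine Finset.sum_congr rfl fun e _ => ?_
    rw [drop_apply]
    split_ifs <;> ring
  · rw [← hh.2 h hh.1, form_apply, energy]
    congr 1
    refine Finset.sum_congr rfl fun e he => ?_
    have := (G.cond_pos e he).ne'
    field_simp

/-- A potential bounds the effective resistance from below. -/
lemma ofReal_inv_le_Reff [Fintype V] {G : WeightedGraph V E} {s t : V} {φ : V → ℝ}
    (hst : φ s - φ t = 1) {C₀ : ℝ} (hC₀ : 0 < C₀)
    (hφ : ∑ e ∈ G.edges, G.cond e * G.drop e φ ^ 2 ≤ C₀) :
    ENNReal.ofReal C₀⁻¹ ≤ G.Reff s t := by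
  classical
  refine le_iInf₂ fun f hf => ENNReal.ofReal_le_ofReal ?_
  -- Summation by parts; Cauchy–Schwarz below then bounds `1` by the energy of the flow times that
  -- of the potential.
  have hflow : ∑ e ∈ G.edges, f e * G.drop e φ = 1 := by
    have h1 : ∀ p : E → V, ∑ v, φ v * ∑ e ∈ G.edges with p e = v, f e
        = ∑ e ∈ G.edges, φ (p e) * f e := by
      intro p
      rw [← Finset.sum_fiberwise G.edges p]
      refine Finset.sum_congr rfl fun v _ => ?_
      rw [Finset.mul_sum]
      refine Finset.sum_congr rfl fun e he => ?_
      rw [(Finset.mem_filter.mp he).2]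
    have h2 : ∑ v, φ v * ((∑ e ∈ G.edges with G.src e = v, f e)
        - ∑ e ∈ G.edges with G.tgt e = v, f e) = 1 := by
      rw [← hst]
      simp only [hf _]
      simp [mul_sub, Finset.sum_sub_distrib]
    simp only [mul_sub, Finset.sum_sub_distrib, h1] at h2
    rw [← h2, ← Finset.sum_sub_distrib]
    refine Finset.sum_congr rfl fun e _ => ?_
    rw [drop_apply]
    ring
  have hcs := Finset.sum_sq_le_sum_mul_sum_of_sq_le_mul G.edges
    (r := fun e => f e * G.drop e φ) (f := fun e => f e ^ 2 / G.cond e)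
    (g := fun e => G.cond e * G.drop e φ ^ 2)
    (fun e he => div_nonneg (sq_nonneg _) (G.cond_pos e he).le)
    (fun e he => mul_nonneg (G.cond_pos e he).le (sq_nonneg _))
    (fun e he => le_of_eq (by
      have := (G.cond_pos e he).ne'
      field_simp))
  rw [hflow, one_pow] at hcs
  have hen : 0 ≤ G.energy f :=
    Finset.sum_nonneg fun e he => div_nonneg (sq_nonneg _) (G.cond_pos e he).le
  rw [inv_le_iff_one_le_mul₀ hC₀]
  exact hcs.trans (mul_le_mul_of_nonneg_left hφ hen)

open Classical in
/-- A good tree admits a small set of edges whose deletion keeps the effective resistance large. -/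
lemma IsGood.exists_deletion [Fintype V] {G : WeightedGraph V E} {F : Finset E}
    {s t : V} {m : ℕ} {C₀ : ℝ} (hC₀ : 0 < C₀) {T : Finset E} (h : G.IsGood F s t m C₀ T) :
    ∃ F' ⊆ F, F'.card ≤ m ∧ ENNReal.ofReal C₀⁻¹ ≤
      (G.conditionDelete F T F').Reff (Quotient.mk _ s) (Quotient.mk _ t) := by
  obtain ⟨F', hF', hcard, φ, hflat, hst, hE⟩ := h
  refine ⟨F', hF', hcard, ?_⟩
  let D := G.delete ((F \ T) ∪ F')
  let φ' : Quotient (D.joinedSetoid ((T ∩ F) \ F')) → ℝ :=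
    Quotient.lift φ fun u v huv => Joined.eq_of_flatOn (G := D) (A := (T ∩ F) \ F') huv hflat
  refine ofReal_inv_le_Reff (s := Quotient.mk _ s) (t := Quotient.mk _ t) (φ := φ') hst hC₀ (le_trans ?_ hE)
  -- Every edge of `F` has been deleted or contracted, so only edges outside `F` survive.
  refine Finset.sum_le_sum_of_subset_of_nonneg (f := fun e => G.cond e * G.drop e φ ^ 2) ?_
    fun e he _ => mul_nonneg (G.cond_pos e (Finset.mem_sdiff.mp he).1).le (sq_nonneg _)
  intro e he
  simp only [conditionDelete, contract, delete, Finset.mem_sdiff, Finset.mem_union,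
    Finset.mem_inter] at he ⊢
  tauto

end WeightedGraph

/-! ### Choice of the parameters -/

theorem mainTheorem3 (a : ℝ) (ha : 0 < a) :
    ∃ C : ℝ, 0 < C ∧
      ∀ (V : Type*) (E : Type*) [Fintype V] (G : WeightedGraph V E) (_ : G.Connected)
        (F : Finset E) (_ : F ⊆ G.edges) (ε : ℝ) (_ : 0 < ε) (_ : ε < 1) (s t : V),
        1 - (Fintype.card V : ℝ) ^ (-a) ≤
          G.treeProb fun T =>
            ∃ F' : Finset E, F' ⊆ F ∧
              ENNReal.ofReal (1 - ε) * G.Reff s t ≤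
                (G.conditionDelete F T F').Reff (Quotient.mk _ s) (Quotient.mk _ t) ∧
              (F'.card : ℝ) ≤ C * Real.log (Fintype.card V) / ε ^ 2 := by
  classical
  -- The final exponent is `-(m * ε ^ 2 / 480)`, and rounding down to `m` costs at most a factor
  -- `2`. The summand `1` keeps `l ≥ 1` for small `a`.
  refine ⟨960 * (a + 1), by positivity, ?_⟩
  intro V E _ G hG F _ ε hε hε1 s t
  have hZ : 0 < WeightedGraph.treeSum G.cond G.IsSpanningTree ∅ G.edges := by
    obtain ⟨T, hT⟩ := hG.exists_isSpanningTree
    exact (WeightedGraph.treeSum_pos_iff G.cond_pos).mpr ⟨T, hT.1, by rwa [Finset.empty_union]⟩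
  obtain ⟨h, hh⟩ := WeightedGraph.exists_isRep (K := ∅) G.cond_pos
    (fun φ hφ => WeightedGraph.const_of_treeSum_pos G.cond_pos hZ hφ) s t
  have hReff := WeightedGraph.Reff_le_diff hh
  have hcard : 1 ≤ Fintype.card V := Fintype.card_pos_iff.mpr ⟨s⟩
  have hcard' : (1 : ℝ) ≤ Fintype.card V := by exact_mod_cast hcard
  set n : ℝ := ((Fintype.card V : ℕ) : ℝ) with hn
  set x := 960 * (a + 1) * Real.log n / ε ^ 2 with hx
  have hx0 : 0 ≤ x := by
    have := Real.log_nonneg hcard'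
    positivity
  rcases (hh.apply_self_nonneg G.cond_pos).eq_or_lt with hR | hR
  · rw [← hR, ENNReal.ofReal_zero, nonpos_iff_eq_zero] at hReff
    refine WeightedGraph.one_sub_le_treeProb (Q := fun _ => True) hZ
      (fun T _ => ⟨∅, Finset.empty_subset _, by simp [hReff], by simpa using hx0⟩) ?_
    rw [WeightedGraph.treeSum_eq_zero (by simp)]
    positivity
  · have hst : s ≠ t := by
      rintro rfl
      simp at hR
    have hn2 : (2 : ℝ) ≤ n := by
      have : 1 < Fintype.card V := Fintype.one_lt_card_iff.mpr ⟨s, t, hst⟩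
      rw [hn]
      exact_mod_cast this
    have hlog : 1 / 2 ≤ Real.log n := by
      have h1 := Real.log_le_log (by norm_num) hn2
      have h2 := Real.log_two_gt_d9
      linarith
    set m := ⌊x⌋₊ with hm
    have hxε : x * ε ^ 2 = 960 * (a + 1) * Real.log n := by
      rw [hx]; field_simp
    have hx2 : 480 ≤ x * ε ^ 2 := by
      rw [hxε]
      nlinarith [mul_nonneg ha.le (by linarith : 0 ≤ Real.log n)]
    have hεsq : ε ^ 2 ≤ ε := by nlinarith
    have hx3 : 480 ≤ x * ε := hx2.trans (mul_le_mul_of_nonneg_left hεsq hx0)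
    have hx4 : 480 ≤ x := hx3.trans (mul_le_of_le_one_right hx0 hε1.le)
    have hmx : x / 2 ≤ m := by
      have := Nat.lt_floor_add_one x
      linarith
    have hmpos : (0 : ℝ) < m := by linarith
    have hm0 : 0 < m := by exact_mod_cast hmpos
    have hmε : 240 ≤ m * ε := by
      have := mul_le_mul_of_nonneg_right hmx hε.le
      linarith
    have hmε2 : 480 * (a * Real.log n) ≤ m * ε ^ 2 := by
      have h1 := mul_le_mul_of_nonneg_right hmx (sq_nonneg ε)
      have h2 : x / 2 * ε ^ 2 = 480 * (a * Real.log n) + 480 * Real.log n := by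
        linear_combination hxε / 2
      linarith
    set R := WeightedGraph.diff s t h with hRdef
    -- This minimises the exponent `120 * l ^ 2 / m - ε * l`.
    set l := ε * m / 240 with hl
    have hl1 : 1 ≤ l := by rw [hl]; linarith
    have hlm : l / m = ε / 240 := by rw [hl]; field_simp
    have hC₀ : 0 < ((1 - ε) * R)⁻¹ := inv_pos.mpr (mul_pos (by linarith) hR)
    refine WeightedGraph.one_sub_le_treeProb hZ (fun T hT => ?_)
      ((WeightedGraph.treeSum_bad_le (F := F) hC₀ hl1 hm0 (by rw [hlm]; linarith) hZ hh hR).trans ?_)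
    · obtain ⟨F', hF', hF'm, hF'R⟩ := hT.exists_deletion hC₀
      refine ⟨F', hF', le_trans ?_ hF'R, ?_⟩
      · rw [inv_inv, ENNReal.ofReal_mul (by linarith)]
        gcongr
      · exact (Nat.cast_le.mpr hF'm).trans (Nat.floor_le hx0)
    · refine mul_le_mul_of_nonneg_right ?_ hZ.le
      have h1 : ((1 - ε) * R)⁻¹ * R = (1 - ε)⁻¹ := by
        rw [mul_inv, mul_assoc, inv_mul_cancel₀ hR.ne', mul_one]
      have h2 : (1 - ε)⁻¹ ^ (-l) ≤ Real.exp (-(ε * l)) := by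
        rw [Real.rpow_neg (by rw [inv_nonneg]; linarith), Real.inv_rpow (by linarith), inv_inv,
          Real.rpow_def_of_pos (by linarith), Real.exp_le_exp]
        have := Real.log_le_sub_one_of_pos (by linarith : 0 < 1 - ε)
        nlinarith
      have h3 : 120 * l ^ 2 / m = ε * l / 2 := by
        have : 120 * l ^ 2 / m = 120 * l * (l / m) := by ring
        rw [this, hlm]
        ring
      rw [← hRdef, h1, h3]
      refine (mul_le_mul_of_nonneg_left h2 (Real.exp_pos _).le).trans ?_
      rw [← Real.exp_add, Real.rpow_def_of_pos (by linarith), Real.exp_le_exp]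
      have h4 : ε * l = m * ε ^ 2 / 240 := by rw [hl]; ring
      rw [h4]
      linarith
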